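/- Let $m,n\in\mathbb N$, let $2\le p<\infty$ and $1\le k\le n$. For a complex $m\times n$ matrix $X$ let $\sigma_1(X)\ge\sigma_2(X)\ge\cdots\ge\sigma_{\min\{m,n\}}(X)$ be its singular values, put $\sigma_i(X)=0$ for $i>\min\{m,n\}$, and let $$\|X\|_{(p,k)}=\bigl(\sigma_1^p(X)+\cdots+\sigma_k^p(X)\bigr)^{1/p}$$ be the Ky Fan $p$-$k$ norm. For $A,B\in\mathbb M_{m\times n}(\mathbb C)$, say that $A$ is norm-parallel to $B$, written $A\parallel B$, if $\|A+\mu B\|_{(p,k)}=\|A\|_{(p,k)}+\|B\|_{(p,k)}$ for some $\mu\in\mathbb C$ with $|\mu|=1$. Write $\langle x,y\rangle=y^*x$ on $\mathbb C^n$, and let $(A^*A)^{(p-2)/2}$ be the power of the positive semidefinite matrix $A^*A$ given by the spectral theorem (the identity matrix if $p=2$). Then for all $A,B\in\mathbb M_{m\times n}(\mathbb C)$: $A\parallel B$ if and only if there exist $k$ orthonormal vectors $v_1,\dots,v_k\in\mathbb C^n$ satisfying $$A^*Av_i=\sigma_i^2(A)\,v_i\quad\text{for all }1\le i\le k$$ and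 a scalar $\lambda\in\mathbb C$, $|\lambda|=1$, such that $$\sum_{i=1}^{k}\bigl\langle (A^*A)^{\frac{p-2}{2}}A^*B\,v_i,v_i\bigr\rangle=\lambda\,\|A\|_{(p,k)}^{\,p-1}\,\|B\|_{(p,k)} .$$ -/

import Mathlib

open scoped Matrix

noncomputable section

namespace KyFanPK

/-- `sval A i` is the `(i+1)`-st largest singular value of the complex `m × n` matrix `A`
(counted with multiplicity, zero-based index), acting between Euclidean spaces; it is `0` for
`i ≥ min m n`. -/
def sval {m n : ℕ} (A : Matrix (Fin m) (Fin n) ℂ) (i : ℕ) : ℝ :=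
  (Matrix.toEuclideanLin A).singularValues i

/-- The Ky Fan `p`-`k` norm: the `ℓ^p` norm of the `k` largest singular values. -/
def kyFanNorm {m n : ℕ} (p : ℝ) (k : ℕ) (A : Matrix (Fin m) (Fin n) ℂ) : ℝ :=
  (∑ i ∈ Finset.range k, sval A i ^ p) ^ (1 / p)

/-- Norm parallelism of `A` and `B` with respect to the Ky Fan `p`-`k` norm. -/
def NormParallel {m n : ℕ} (p : ℝ) (k : ℕ) (A B : Matrix (Fin m) (Fin n) ℂ) : Prop :=
  ∃ c : ℂ, ‖c‖ = 1 ∧ kyFanNorm p k (A + c • B) = kyFanNorm p k A + kyFanNorm p k B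

/-- The real power `(A⋆ A) ^ s`, i.e. `U * diag (d_j ^ s) * U⋆` for a spectral decomposition
`A⋆ A = U * diag d_j * U⋆`; for `s = 0` it is the identity. -/
def gramPow {m n : ℕ} (A : Matrix (Fin m) (Fin n) ℂ) (s : ℝ) : Matrix (Fin n) (Fin n) ℂ :=
  (Matrix.isHermitian_conjTranspose_mul_self A).cfc (fun x : ℝ => x ^ s)

end KyFanPK

end

/-! For orthonormal v_i, sum ‖A v_i‖^p ≤ ‖A‖^p, with equality when the v_i are top right singular
vectors of A. Take such vectors for A + cB. The triangle inequality in the target space followed by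
Minkowski's inequality gives ‖A + cB‖ ≤ ‖A‖ + ‖B‖. If A ∥ B, every step is an equality. Strict
convexity then forces ‖A‖ cB v_i = ‖B‖ A v_i, a linear relation that persists on V = span(v_i), and
the v_i are extremal for A. Extremality does not make each v_i singular for A, but it gives V an
orthonormal basis of top right singular vectors of A (`sum_norm_apply_rpow_le`). Substituting B
there yields the trace identity. Conversely, the functional C ↦ sum σ_i^(p-2) ⟨A v_i, C v_i⟩ is
bounded by ‖A‖^(p-1) ‖C‖ (Hölder). Its value at A is ‖A‖^p, so attaining the bound at B up to a
phase makes it attain ‖A‖^(p-1) (‖A‖ + ‖B‖) at a rotated sum. -/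

namespace KyFanPK

/-! ### Scalar inequalities and their equality cases -/

section Scalar

open Finset

/-- A sum of `n` nonincreasing numbers with weights in `[0, 1]` of total weight `k` is at most the
sum of the `k` largest ones; in the equality case the weights are forced off the pivot value. -/
theorem sum_weight_mul_le {n k : ℕ} (hk : 1 ≤ k) (hkn : k ≤ n) {d : ℕ → ℝ} (hd : Antitone d)
    {a : Fin n → ℝ} (ha0 : ∀ l, 0 ≤ a l) (ha1 : ∀ l, a l ≤ 1) (hsum : ∑ l, a l = k) :
    ∑ l, a l * d l ≤ ∑ l ∈ range k, d l ∧
      (∑ l ∈ range k, d l ≤ ∑ l, a l * d l →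
        ∀ l : Fin n, (d (k - 1) < d l → a l = 1) ∧ (d l < d (k - 1) → a l = 0)) := by
  set w : Fin n → ℝ := fun l => if (l : ℕ) < k then 1 else 0 with hw
  have hfin : ∀ g : ℕ → ℝ, ∑ l : Fin n, w l * g l = ∑ l ∈ range k, g l := by
    intro g
    rw [Fin.sum_univ_eq_sum_range (fun l => (if l < k then 1 else 0) * g l) n]
    rw [← Finset.sum_subset (Finset.range_mono hkn)]
    · refine Finset.sum_congr rfl fun l hl => ?_
      simp [Finset.mem_range.1 hl]
    · intro l _ hl
      simp only [Finset.mem_range] at hl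
      simp [hl]
  -- Both weights `w` and `a` have total `k`, so subtracting the pivot `d (k - 1)` leaves the
  -- difference of the weighted sums unchanged and makes every term nonnegative.
  have hpos : ∀ l : Fin n, 0 ≤ (w l - a l) * (d l - d (k - 1)) := by
    intro l
    by_cases hl : (l : ℕ) < k
    · have : d (k - 1) ≤ d l := hd (by omega)
      exact mul_nonneg (by simp [hw, hl, ha1]) (by linarith)
    · have : d l ≤ d (k - 1) := hd (by omega)
      exact mul_nonneg_of_nonpos_of_nonpos (by simp [hw, hl, ha0]) (by linarith)
  have hid : ∑ l : Fin n, (w l - a l) * (d l - d (k - 1)) =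
      ∑ l ∈ range k, d l - ∑ l, a l * d l := by
    have h1 := hfin d
    have h2 := hfin fun _ => 1
    simp only [mul_one, sum_const, card_range, nsmul_eq_mul] at h2
    calc _ = ∑ l : Fin n, (w l * d l - a l * d l - (w l - a l) * d (k - 1)) := by
          refine Finset.sum_congr rfl fun l _ => by ring
      _ = _ := by
          rw [sum_sub_distrib, sum_sub_distrib, ← sum_mul, sum_sub_distrib, h1, h2, hsum]; ring
  have hnn := Finset.sum_nonneg fun l (_ : l ∈ univ) => hpos l
  refine ⟨by linarith, fun hle l => ?_⟩
  have hz := (Finset.sum_eq_zero_iff_of_nonneg fun l _ => hpos l).1 (by linarith) l (mem_univ l)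
  refine ⟨fun h => ?_, fun h => ?_⟩
  · have hl : (l : ℕ) < k := by
      by_contra hc
      exact absurd (hd (show k - 1 ≤ (l : ℕ) by omega)) (not_le.2 h)
    have := (mul_eq_zero.1 hz).resolve_right (by linarith)
    simp only [hw, hl, if_true] at this
    linarith
  · have hl : ¬ (l : ℕ) < k := by
      intro hc
      exact absurd (hd (show (l : ℕ) ≤ k - 1 by omega)) (not_le.2 h)
    have := (mul_eq_zero.1 hz).resolve_right (by linarith)
    simp only [hw, hl, if_false] at this
    linarith

/-- Strict convexity of t ↦ t^p: (a + b)/(α + β) is the mean of a/α and b/β with weights α/(α + β)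
and β/(α + β). -/
theorem add_rpow_le_of_pos {p α β a b : ℝ} (hp : 1 < p) (hα : 0 < α) (hβ : 0 < β)
    (ha : 0 ≤ a) (hb : 0 ≤ b) :
    (a + b) ^ p ≤ (α + β) ^ p *
        (α / (α + β) * (a ^ p / α ^ p) + β / (α + β) * (b ^ p / β ^ p)) ∧
      ((α + β) ^ p * (α / (α + β) * (a ^ p / α ^ p) + β / (α + β) * (b ^ p / β ^ p)) ≤
        (a + b) ^ p → β * a = α * b) := by
  have hs : 0 < α + β := add_pos hα hβ
  have hsp : 0 < (α + β) ^ p := Real.rpow_pos_of_pos hs p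
  have hw : α / (α + β) + β / (α + β) = 1 := by field_simp
  have key : (a + b) ^ p = (α + β) ^ p *
      (α / (α + β) * (a / α) + β / (α + β) * (b / β)) ^ p := by
    rw [← Real.mul_rpow hs.le (by positivity)]
    congr 1
    field_simp
  rw [← Real.div_rpow ha hα.le, ← Real.div_rpow hb hβ.le, key]
  refine ⟨?_, fun h => ?_⟩
  · exact mul_le_mul_of_nonneg_left ((strictConvexOn_rpow hp).convexOn.2
      (show (0 : ℝ) ≤ a / α by positivity) (show (0 : ℝ) ≤ b / β by positivity)
      (by positivity) (by positivity) hw) hsp.le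
  · by_contra hne
    have hne' : a / α ≠ b / β := by
      intro he
      rw [div_eq_div_iff hα.ne' hβ.ne'] at he
      exact hne (by linarith)
    have := (strictConvexOn_rpow hp).2 (show (0 : ℝ) ≤ a / α by positivity)
      (show (0 : ℝ) ≤ b / β by positivity) hne' (show 0 < α / (α + β) by positivity)
      (show 0 < β / (α + β) by positivity) hw
    exact absurd (le_of_mul_le_mul_left h hsp) (not_le.2 this)

/-- Minkowski's inequality together with its equality case. -/
theorem sum_rpow_le_add_rpow {ι : Type*} [Fintype ι] {p α β : ℝ} (hp : 1 < p) (hα : 0 < α)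
    (hβ : 0 < β) {a b c : ι → ℝ} (ha : ∀ i, 0 ≤ a i) (hb : ∀ i, 0 ≤ b i) (hc : ∀ i, 0 ≤ c i)
    (hcab : ∀ i, c i ≤ a i + b i) (hA : ∑ i, a i ^ p ≤ α ^ p) (hB : ∑ i, b i ^ p ≤ β ^ p) :
    ∑ i, c i ^ p ≤ (α + β) ^ p ∧
      ((α + β) ^ p ≤ ∑ i, c i ^ p →
        (∀ i, c i = a i + b i ∧ β * a i = α * b i) ∧ α ^ p ≤ ∑ i, a i ^ p) := by
  have hs : 0 < α + β := add_pos hα hβ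
  have hp0 : 0 < p := by linarith
  have hsp : 0 < (α + β) ^ p := Real.rpow_pos_of_pos hs p
  have hαp : 0 < α ^ p := Real.rpow_pos_of_pos hα p
  have hβp : 0 < β ^ p := Real.rpow_pos_of_pos hβ p
  set g : ι → ℝ := fun i => (α + β) ^ p *
    (α / (α + β) * (a i ^ p / α ^ p) + β / (α + β) * (b i ^ p / β ^ p)) with hg
  have h1 : ∀ i, c i ^ p ≤ (a i + b i) ^ p := fun i =>
    Real.rpow_le_rpow (hc i) (hcab i) hp0.le
  have h2 : ∀ i, (a i + b i) ^ p ≤ g i := fun i =>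
    (add_rpow_le_of_pos hp hα hβ (ha i) (hb i)).1
  have hgsum : ∑ i, g i = (α + β) ^ p * (α / (α + β) * ((∑ i, a i ^ p) / α ^ p) +
      β / (α + β) * ((∑ i, b i ^ p) / β ^ p)) := by
    simp only [hg, ← mul_sum, sum_add_distrib, ← sum_div]
  have hA' : (∑ i, a i ^ p) / α ^ p ≤ 1 := (div_le_one hαp).2 hA
  have hB' : (∑ i, b i ^ p) / β ^ p ≤ 1 := (div_le_one hβp).2 hB
  have hw : α / (α + β) + β / (α + β) = 1 := by field_simp
  have hwα : 0 < α / (α + β) := by positivity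
  have hwβ : 0 < β / (α + β) := by positivity
  have hBm := mul_le_mul_of_nonneg_left hB' hwβ.le
  have hAm := mul_le_mul_of_nonneg_left hA' hwα.le
  have hgle : ∑ i, g i ≤ (α + β) ^ p := by
    rw [hgsum]
    exact mul_le_of_le_one_right hsp.le (by linarith)
  refine ⟨(sum_le_sum fun i _ => (h1 i).trans (h2 i)).trans hgle, fun h => ⟨fun i => ?_, ?_⟩⟩
  · have he : c i ^ p = g i := by
      refine (sum_eq_sum_iff_of_le fun i _ => (h1 i).trans (h2 i)).1 ?_ i (mem_univ i)
      exact le_antisymm (sum_le_sum fun i _ => (h1 i).trans (h2 i)) (hgle.trans h)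
    refine ⟨?_, (add_rpow_le_of_pos hp hα hβ (ha i) (hb i)).2 (he.symm.le.trans (h1 i))⟩
    exact (Real.rpow_left_inj (hc i) (add_nonneg (ha i) (hb i)) hp0.ne').1
      (le_antisymm (h1 i) ((h2 i).trans he.symm.le))
  -- A weighted mean of two ratios, each at most 1, can reach 1 only if both equal 1.
  · have h3 : (α + β) ^ p ≤ ∑ i, g i :=
      h.trans (sum_le_sum fun i _ => (h1 i).trans (h2 i))
    rw [hgsum] at h3
    have h4 := (le_mul_iff_one_le_right hsp).1 h3
    have h5 : α / (α + β) * 1 ≤ α / (α + β) * ((∑ i, a i ^ p) / α ^ p) := by linarith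
    exact (one_le_div hαp).1 (le_of_mul_le_mul_left h5 hwα)

end Scalar

/-! ### Singular values and extremal orthonormal families -/

section LinearMap

open Module InnerProductSpace LinearMap Finset

/-- Equality in Bessel's inequality: the residual of the orthogonal projection `y` has norm zero. -/
theorem mem_span_of_sum_sq_norm_inner_eq {𝕜 E ι : Type*} [RCLike 𝕜] [NormedAddCommGroup E]
    [InnerProductSpace 𝕜 E] [Fintype ι] {v : ι → E} (hv : Orthonormal 𝕜 v) {x : E} (hx : ∑ i, ‖inner 𝕜 (v i) x‖ ^ 2 = ‖x‖ ^ 2) :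
    x ∈ Submodule.span 𝕜 (Set.range v) := by
  set y : E := ∑ i, inner 𝕜 (v i) x • v i with hy
  have hvy : ∀ i, inner 𝕜 (v i) y = inner 𝕜 (v i) x := fun i => hv.inner_right_fintype _ i
  have hyy : inner 𝕜 y (x - y) = 0 := by
    rw [hy, sum_inner]
    refine Finset.sum_eq_zero fun i _ => ?_
    rw [inner_smul_left, inner_sub_right, hvy, sub_self, mul_zero]
  have hxy : inner 𝕜 x y = ((∑ i, ‖inner 𝕜 (v i) x‖ ^ 2 : ℝ) : 𝕜) := by
    rw [hy, inner_sum]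
    push_cast
    refine Finset.sum_congr rfl fun i _ => ?_
    rw [inner_smul_right, ← inner_conj_symm x (v i), RCLike.mul_conj]
  have h0 : inner 𝕜 (x - y) (x - y) = 0 := by
    rw [inner_sub_left, hyy, sub_zero, inner_sub_right, hxy, hx, inner_self_eq_norm_sq_to_K]
    push_cast
    ring
  rw [sub_eq_zero.1 (inner_self_eq_zero.1 h0)]
  exact Submodule.sum_mem _ fun i _ => Submodule.smul_mem _ _ (Submodule.subset_span ⟨i, rfl⟩)

variable {𝕜 E F : Type*} [RCLike 𝕜] [NormedAddCommGroup E] [InnerProductSpace 𝕜 E]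
  [FiniteDimensional 𝕜 E] [NormedAddCommGroup F] [InnerProductSpace 𝕜 F] [FiniteDimensional 𝕜 F]

theorem exists_rightSingularBasis (T : E →ₗ[𝕜] F) {n : ℕ} (hn : finrank 𝕜 E = n) :
    ∃ e : OrthonormalBasis (Fin n) 𝕜 E,
      ∀ i, (adjoint T ∘ₗ T) (e i) = ((T.singularValues i ^ 2 : ℝ) : 𝕜) • e i := by
  refine ⟨T.isSymmetric_adjoint_comp_self.eigenvectorBasis hn, fun i => ?_⟩
  rw [T.sq_singularValues_fin hn]
  exact T.isSymmetric_adjoint_comp_self.apply_eigenvectorBasis hn i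

theorem inner_gram_of_eigenvector (T : E →ₗ[𝕜] F) {e : E} {r : ℝ}
    (he : (adjoint T ∘ₗ T) e = (r : 𝕜) • e) (x : E) :
    inner 𝕜 e ((adjoint T ∘ₗ T) x) = (r : 𝕜) * inner 𝕜 e x := by
  rw [← T.isSymmetric_adjoint_comp_self e x, he, inner_smul_left, RCLike.conj_ofReal]

theorem norm_sq_apply_of_gram_eigenvector (T : E →ₗ[𝕜] F) {e : E} {r : ℝ}
    (he : (adjoint T ∘ₗ T) e = (r : 𝕜) • e) : ‖T e‖ ^ 2 = r * ‖e‖ ^ 2 := by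
  have h : inner 𝕜 e ((adjoint T ∘ₗ T) e) = inner 𝕜 (T e) (T e) := by
    rw [LinearMap.comp_apply, adjoint_inner_right]
  rw [inner_gram_of_eigenvector T he, inner_self_eq_norm_sq_to_K, inner_self_eq_norm_sq_to_K] at h
  exact_mod_cast h.symm

theorem norm_apply_of_gram_eigenvector (T : E →ₗ[𝕜] F) {e : E} {r : ℝ} (hr : 0 ≤ r)
    (h1 : ‖e‖ = 1) (he : (adjoint T ∘ₗ T) e = ((r ^ 2 : ℝ) : 𝕜) • e) : ‖T e‖ = r := by
  have := norm_sq_apply_of_gram_eigenvector T he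
  rw [h1, one_pow, mul_one] at this
  exact (pow_left_inj₀ (norm_nonneg _) hr two_ne_zero).1 this

theorem norm_sq_apply_eq_sum (T : E →ₗ[𝕜] F) {n : ℕ} (e : OrthonormalBasis (Fin n) 𝕜 E)
    {r : Fin n → ℝ} (he : ∀ i, (adjoint T ∘ₗ T) (e i) = (r i : 𝕜) • e i) (x : E) :
    ‖T x‖ ^ 2 = ∑ l, ‖inner 𝕜 (e l) x‖ ^ 2 * r l := by
  have h : inner 𝕜 x ((adjoint T ∘ₗ T) x) = inner 𝕜 (T x) (T x) := by
    rw [LinearMap.comp_apply, adjoint_inner_right]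
  rw [← e.sum_inner_mul_inner, inner_self_eq_norm_sq_to_K] at h
  have h2 : ∀ l, inner 𝕜 x (e l) * inner 𝕜 (e l) ((adjoint T ∘ₗ T) x) =
      ((‖inner 𝕜 (e l) x‖ ^ 2 * r l : ℝ) : 𝕜) := by
    intro l
    rw [inner_gram_of_eigenvector T (he l), mul_left_comm, ← inner_conj_symm, RCLike.conj_mul]
    push_cast
    ring
  simp only [h2] at h
  exact_mod_cast h.symm

/-- Jensen's inequality for t ↦ t^(p/2), convex because p ≥ 2, with the probability weights |⟨e_l,
x⟩|². -/
theorem norm_apply_rpow_le_sum (T : E →ₗ[𝕜] F) {n : ℕ} (e : OrthonormalBasis (Fin n) 𝕜 E)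
    {σ : Fin n → ℝ} (hσ : ∀ i, 0 ≤ σ i)
    (he : ∀ i, (adjoint T ∘ₗ T) (e i) = ((σ i ^ 2 : ℝ) : 𝕜) • e i) {p : ℝ} (hp : 2 ≤ p)
    {x : E} (hx : ‖x‖ = 1) :
    ‖T x‖ ^ p ≤ ∑ l, ‖inner 𝕜 (e l) x‖ ^ 2 * σ l ^ p := by
  have hpow : ∀ t : ℝ, 0 ≤ t → (t ^ 2) ^ (p / 2) = t ^ p := by
    intro t ht
    rw [← Real.rpow_natCast, ← Real.rpow_mul ht]
    congr 1
    push_cast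
    ring
  rw [← hpow _ (norm_nonneg _), norm_sq_apply_eq_sum T e he x]
  have := (convexOn_rpow (show 1 ≤ p / 2 by linarith)).map_sum_le (t := univ)
    (w := fun l => ‖inner 𝕜 (e l) x‖ ^ 2) (p := fun l => σ l ^ 2)
    (fun _ _ => by positivity) (by rw [e.sum_sq_norm_inner_right, hx, one_pow])
    (fun l _ => sq_nonneg (σ l))
  simpa only [smul_eq_mul, hpow _ (hσ _)] using this

/-- The sum of `p`-th powers of the norms of the images of `k` orthonormal vectors is at most the
sum of the `p`-th powers of the `k` largest singular values; in the equality case, the span of the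
vectors has an orthonormal basis of right singular vectors. -/
theorem sum_norm_apply_rpow_le (T : E →ₗ[𝕜] F) {k : ℕ} (hk : 1 ≤ k) {p : ℝ} (hp : 2 ≤ p)
    {v : Fin k → E} (hv : Orthonormal 𝕜 v) :
    ∑ i, ‖T (v i)‖ ^ p ≤ ∑ l ∈ range k, T.singularValues l ^ p ∧
      (∑ l ∈ range k, T.singularValues l ^ p ≤ ∑ i, ‖T (v i)‖ ^ p →
        ∃ u : Fin k → E, Orthonormal 𝕜 u ∧ (∀ i, u i ∈ Submodule.span 𝕜 (Set.range v)) ∧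
          ∀ i : Fin k, (adjoint T ∘ₗ T) (u i) = ((T.singularValues i ^ 2 : ℝ) : 𝕜) • u i) := by
  obtain ⟨e, he⟩ := exists_rightSingularBasis T rfl
  have hkn : k ≤ finrank 𝕜 E := by
    simpa using hv.linearIndependent.fintype_card_le_finrank
  have hp0 : 0 < p := by linarith
  set d : ℕ → ℝ := fun l => T.singularValues l ^ p with hd
  have hdanti : Antitone d := fun i j hij =>
    Real.rpow_le_rpow (T.singularValues_nonneg j) (T.singularValues_antitone hij) hp0.le
  -- `a l` is the squared norm of the projection of `e l` onto the span of `v`: value 1 means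
  -- membership, value 0 means orthogonality.
  set a : Fin (finrank 𝕜 E) → ℝ := fun l => ∑ i, ‖inner 𝕜 (v i) (e l)‖ ^ 2 with ha
  have ha1 : ∀ l, a l ≤ 1 := fun l => by
    have := hv.sum_inner_products_le (x := e l) (s := univ)
    rwa [e.norm_eq_one, one_pow] at this
  have hsum : ∑ l, a l = k := by
    rw [ha, Finset.sum_comm]
    simp [e.sum_sq_norm_inner_left, hv.norm_eq_one]
  have hT : ∑ i, ‖T (v i)‖ ^ p ≤ ∑ l, a l * d l := by
    calc ∑ i, ‖T (v i)‖ ^ p ≤ ∑ i, ∑ l, ‖inner 𝕜 (e l) (v i)‖ ^ 2 * d l :=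
          sum_le_sum fun i _ => norm_apply_rpow_le_sum T e
            (fun i => T.singularValues_nonneg i) he hp (hv.norm_eq_one i)
      _ = ∑ l, a l * d l := by
          rw [Finset.sum_comm]
          simp only [ha, sum_mul, norm_inner_symm]
  have hpiv := sum_weight_mul_le hk hkn hdanti
    (fun l => sum_nonneg fun i _ => sq_nonneg _) ha1 hsum
  refine ⟨hT.trans hpiv.1, fun hle => ?_⟩
  have hpiv' := hpiv.2 (hle.trans hT)
  set V := Submodule.span 𝕜 (Set.range v) with hV
  have hmem : ∀ l : Fin (finrank 𝕜 E), T.singularValues (k - 1) < T.singularValues l →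
      e l ∈ V := by
    intro l hl
    refine mem_span_of_sum_sq_norm_inner_eq hv ?_
    rw [e.norm_eq_one, one_pow]
    exact (hpiv' l).1 (Real.rpow_lt_rpow (T.singularValues_nonneg _) hl hp0)
  have hperp : ∀ l : Fin (finrank 𝕜 E), T.singularValues l < T.singularValues (k - 1) →
      ∀ x ∈ V, inner 𝕜 (e l) x = 0 := by
    intro l hl x hx
    have h0 := (hpiv' l).2 (Real.rpow_lt_rpow (T.singularValues_nonneg _) hl hp0)
    rw [sum_eq_zero_iff_of_nonneg fun i _ => sq_nonneg _] at h0
    induction hx using Submodule.span_induction with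
    | mem x hx =>
      obtain ⟨i, rfl⟩ := hx
      rw [← inner_conj_symm, norm_eq_zero.1 (pow_eq_zero_iff two_ne_zero |>.1 (h0 i (mem_univ i))),
        map_zero]
    | zero => exact inner_zero_right _
    | add x y _ _ h1 h2 => rw [inner_add_right, h1, h2, add_zero]
    | smul c x _ h => rw [inner_smul_right, h, mul_zero]
  let j : Fin k → Fin (finrank 𝕜 E) := Fin.castLE hkn
  -- The `e l` strictly above the pivot lie in `V`; they are kept and completed to an orthonormal
  -- basis of `V`. The value 0 of `f` is never used on `s`.
  let s : Set (Fin k) := {i | T.singularValues (k - 1) < T.singularValues i}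
  classical
  let f : Fin k → V := fun i => if h : e (j i) ∈ V then ⟨e (j i), h⟩ else 0
  have hf : ∀ i ∈ s, (f i : E) = e (j i) := by
    intro i hi
    have : e (j i) ∈ V := hmem (j i) hi
    simp only [f, dif_pos this]
  have hortho : Orthonormal 𝕜 (s.domRestrict f) := by
    have : Orthonormal 𝕜 fun i : s => e (j i) :=
      e.orthonormal.comp _ ((Fin.castLE_injective hkn).comp Subtype.val_injective)
    rw [← V.subtypeₗᵢ.orthonormal_comp_iff]
    convert! this using 1
    funext i
    exact hf i i.2
  have hcard : finrank 𝕜 V = Fintype.card (Fin k) :=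
    finrank_span_eq_card hv.linearIndependent
  obtain ⟨b, hb⟩ := hortho.exists_orthonormalBasis_extension_of_card_eq hcard
  have hbo : Orthonormal 𝕜 fun i => (b i : E) := b.orthonormal.comp_linearIsometry V.subtypeₗᵢ
  refine ⟨fun i => b i, hbo, fun i => (b i).2, fun i => ?_⟩
  by_cases hi : i ∈ s
  · have hbi : (b i : E) = e (j i) := by rw [hb i hi, hf i hi]
    simp only [hbi]
    exact he (j i)
  · have hσi : T.singularValues i = T.singularValues (k - 1) :=
      le_antisymm (not_lt.1 hi) (T.singularValues_antitone (by have := i.2; omega))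
    -- Test against each `e l`: below the pivot it is orthogonal to `V`, at the pivot the
    -- eigenvalues agree, above it `e l` is another member of the basis `b`.
    refine ext_inner_left_basis e.toBasis fun l => ?_
    rw [e.coe_toBasis, inner_gram_of_eigenvector T (he l), inner_smul_right]
    rcases lt_trichotomy (T.singularValues l) (T.singularValues (k - 1)) with h | h | h
    · rw [hperp l h _ (b i).2, mul_zero, mul_zero]
    · rw [h, hσi]
    · have hlk : (l : ℕ) < k := by
        by_contra hc
        exact absurd (T.singularValues_antitone (show k - 1 ≤ (l : ℕ) by omega)) (not_le.2 h)
      have hls : (⟨l, hlk⟩ : Fin k) ∈ s := h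
      have hbl : (b ⟨l, hlk⟩ : E) = e l := by rw [hb _ hls, hf _ hls]; rfl
      have hne : (⟨l, hlk⟩ : Fin k) ≠ i := fun hc => hi (hc ▸ hls)
      rw [← hbl, hbo.2 hne, mul_zero, mul_zero]

end LinearMap

/-! ### Ky Fan norms of matrices, trace duality and parallelism -/

section Matrix

open Finset

theorem toEuclideanLin_mul_apply {l m n : ℕ} (A : Matrix (Fin l) (Fin m) ℂ)
    (B : Matrix (Fin m) (Fin n) ℂ) (x : EuclideanSpace ℂ (Fin n)) :
    Matrix.toEuclideanLin (A * B) x = Matrix.toEuclideanLin A (Matrix.toEuclideanLin B x) := by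
  simp [Matrix.toLpLin_apply, Matrix.mulVec_mulVec]

theorem toEuclideanLin_gram {m n : ℕ} (A : Matrix (Fin m) (Fin n) ℂ) :
    Matrix.toEuclideanLin (Aᴴ * A) =
      LinearMap.adjoint (Matrix.toEuclideanLin A) ∘ₗ Matrix.toEuclideanLin A := by
  ext1 x
  rw [toEuclideanLin_mul_apply, Matrix.toEuclideanLin_conjTranspose_eq_adjoint,
    LinearMap.comp_apply]

theorem cfc_apply_of_eigenvector {n : ℕ} {A : Matrix (Fin n) (Fin n) ℂ} (hA : A.IsHermitian)
    (f : ℝ → ℝ) {r : ℝ} {x : EuclideanSpace ℂ (Fin n)}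
    (hx : Matrix.toEuclideanLin A x = (r : ℂ) • x) :
    Matrix.toEuclideanLin (hA.cfc f) x = (f r : ℂ) • x := by
  set U : Matrix (Fin n) (Fin n) ℂ := (hA.eigenvectorUnitary : Matrix (Fin n) (Fin n) ℂ) with hU
  have hUU : U * star U = 1 := Unitary.coe_mul_star_self _
  have hUU' : star U * U = 1 := Unitary.coe_star_mul_self _
  have hspec : A = U * Matrix.diagonal (RCLike.ofReal ∘ hA.eigenvalues) * star U :=
    hA.spectral_theorem
  have hcfc : hA.cfc f = U * Matrix.diagonal (RCLike.ofReal ∘ f ∘ hA.eigenvalues) * star U := rfl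
  have hx' : A *ᵥ x.ofLp = (r : ℂ) • x.ofLp := by
    simpa [Matrix.toLpLin_apply] using congrArg WithLp.ofLp hx
  set w : Fin n → ℂ := star U *ᵥ x.ofLp with hw
  have hxw : x.ofLp = U *ᵥ w := by rw [hw, Matrix.mulVec_mulVec, hUU, Matrix.one_mulVec]
  have hd : Matrix.diagonal (RCLike.ofReal ∘ hA.eigenvalues) *ᵥ w = (r : ℂ) • w := by
    have h := congrArg (fun y => star U *ᵥ y) hx'
    simp only [Matrix.mulVec_smul] at h
    rw [← hw] at h
    have hUA : star U * A = Matrix.diagonal (RCLike.ofReal ∘ hA.eigenvalues) * star U := by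
      conv_lhs => rw [hspec]
      rw [← mul_assoc, ← mul_assoc, hUU', one_mul]
    rw [← h, hw, Matrix.mulVec_mulVec, Matrix.mulVec_mulVec, hUA]
  have hd' : Matrix.diagonal (RCLike.ofReal ∘ f ∘ hA.eigenvalues) *ᵥ w = (f r : ℂ) • w := by
    funext i
    have hi := congrFun hd i
    rw [Matrix.mulVec_diagonal, Pi.smul_apply, smul_eq_mul] at hi ⊢
    rcases eq_or_ne (w i) 0 with h0 | h0
    · rw [h0, mul_zero, mul_zero]
    · have := mul_right_cancel₀ h0 hi
      have hr : hA.eigenvalues i = r := by exact Complex.ofReal_injective this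
      simp [hr]
  rw [Matrix.toLpLin_apply, hcfc, ← Matrix.mulVec_mulVec, ← hw, ← Matrix.mulVec_mulVec,
    hd', Matrix.mulVec_smul, ← hxw]
  rfl

theorem gramPow_isHermitian {m n : ℕ} (A : Matrix (Fin m) (Fin n) ℂ) (s : ℝ) :
    (gramPow A s).IsHermitian := by
  rw [gramPow, ← Matrix.IsHermitian.cfc_eq]
  exact cfc_predicate (R := ℝ) _ _

theorem sval_nonneg {m n : ℕ} (A : Matrix (Fin m) (Fin n) ℂ) (i : ℕ) : 0 ≤ sval A i :=
  LinearMap.singularValues_nonneg _ i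

/-- The Hermitian power moves to the left slot, where it acts on `x` as a scalar. For p = 2 and σ =
0 the convention 0^0 = 1 matches the identity matrix. -/
theorem inner_gramPow_apply {m n : ℕ} (A B : Matrix (Fin m) (Fin n) ℂ) (p : ℝ) {σ : ℝ}
    (hσ : 0 ≤ σ) {x : EuclideanSpace ℂ (Fin n)}
    (hx : Matrix.toEuclideanLin (Aᴴ * A) x = ((σ ^ 2 : ℝ) : ℂ) • x) :
    inner ℂ x (Matrix.toEuclideanLin (gramPow A ((p - 2) / 2) * Aᴴ * B) x) =
      ((σ ^ (p - 2) : ℝ) : ℂ) *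
        inner ℂ (Matrix.toEuclideanLin A x) (Matrix.toEuclideanLin B x) := by
  have hpow : (σ ^ 2) ^ ((p - 2) / 2) = σ ^ (p - 2) := by
    rw [← Real.rpow_natCast, ← Real.rpow_mul hσ]
    congr 1
    push_cast
    ring
  have h := cfc_apply_of_eigenvector (Matrix.isHermitian_conjTranspose_mul_self A)
    (fun t : ℝ => t ^ ((p - 2) / 2)) hx
  rw [Matrix.mul_assoc, toEuclideanLin_mul_apply, toEuclideanLin_mul_apply]
  conv_lhs => rw [← (gramPow_isHermitian A ((p - 2) / 2)).eq]
  rw [Matrix.toEuclideanLin_conjTranspose_eq_adjoint, LinearMap.adjoint_inner_right, gramPow, h,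
    inner_smul_left, Matrix.toEuclideanLin_conjTranspose_eq_adjoint,
    LinearMap.adjoint_inner_right, hpow, Complex.conj_ofReal]

theorem kyFanNorm_nonneg {m n : ℕ} (p : ℝ) (k : ℕ) (A : Matrix (Fin m) (Fin n) ℂ) :
    0 ≤ kyFanNorm p k A :=
  Real.rpow_nonneg (sum_nonneg fun i _ => Real.rpow_nonneg (sval_nonneg A i) p) _

theorem kyFanNorm_rpow {m n : ℕ} {p : ℝ} (hp : 0 < p) (k : ℕ) (A : Matrix (Fin m) (Fin n) ℂ) :
    kyFanNorm p k A ^ p = ∑ i ∈ range k, sval A i ^ p := by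
  rw [kyFanNorm, one_div, Real.rpow_inv_rpow
    (sum_nonneg fun i _ => Real.rpow_nonneg (sval_nonneg A i) p) hp.ne']

theorem kyFanNorm_zero {m n : ℕ} {p : ℝ} (hp : 0 < p) (k : ℕ) :
    kyFanNorm p k (0 : Matrix (Fin m) (Fin n) ℂ) = 0 := by
  simp [kyFanNorm, sval, Real.zero_rpow hp.ne', Real.zero_rpow (inv_ne_zero hp.ne')]

theorem kyFanNorm_pos {m n k : ℕ} (hk : 1 ≤ k) (p : ℝ)
    {A : Matrix (Fin m) (Fin n) ℂ} (hA : A ≠ 0) : 0 < kyFanNorm p k A := by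
  have h0 : 0 < sval A 0 := by
    rw [sval, LinearMap.singularValues_pos_iff_ne_zero]
    intro h
    rw [LinearMap.singularValues_eq_zero_iff_le_finrank_range, Nat.le_zero,
      Submodule.finrank_eq_zero, LinearMap.range_eq_bot, LinearEquiv.map_eq_zero_iff] at h
    exact hA h
  refine Real.rpow_pos_of_pos ?_ _
  exact (Real.rpow_pos_of_pos h0 p).trans_le (single_le_sum (f := fun i => sval A i ^ p)
    (fun i _ => Real.rpow_nonneg (sval_nonneg A i) p) (mem_range.2 hk))

/-- The variational upper bound for the Ky Fan norm. -/
theorem sum_norm_apply_rpow_le_kyFanNorm {m n k : ℕ} (hk : 1 ≤ k) {p : ℝ} (hp : 2 ≤ p)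
    (A : Matrix (Fin m) (Fin n) ℂ) {v : Fin k → EuclideanSpace ℂ (Fin n)}
    (hv : Orthonormal ℂ v) :
    ∑ i, ‖Matrix.toEuclideanLin A (v i)‖ ^ p ≤ kyFanNorm p k A ^ p := by
  rw [kyFanNorm_rpow (by linarith)]
  exact (sum_norm_apply_rpow_le _ hk hp hv).1

theorem exists_orthonormal_rightSingular {m n k : ℕ} (hkn : k ≤ n)
    (A : Matrix (Fin m) (Fin n) ℂ) :
    ∃ v : Fin k → EuclideanSpace ℂ (Fin n), Orthonormal ℂ v ∧
      ∀ i : Fin k, Matrix.toEuclideanLin (Aᴴ * A) (v i) = ((sval A i ^ 2 : ℝ) : ℂ) • v i := by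
  obtain ⟨e, he⟩ := exists_rightSingularBasis (Matrix.toEuclideanLin A)
    (finrank_euclideanSpace_fin (𝕜 := ℂ) (n := n))
  refine ⟨fun i => e (Fin.castLE hkn i), e.orthonormal.comp _ (Fin.castLE_injective hkn),
    fun i => ?_⟩
  rw [toEuclideanLin_gram]
  exact he (Fin.castLE hkn i)

theorem norm_apply_rightSingular {m n : ℕ} {A : Matrix (Fin m) (Fin n) ℂ} {i : ℕ}
    {x : EuclideanSpace ℂ (Fin n)} (hx1 : ‖x‖ = 1)
    (hx : Matrix.toEuclideanLin (Aᴴ * A) x = ((sval A i ^ 2 : ℝ) : ℂ) • x) :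
    ‖Matrix.toEuclideanLin A x‖ = sval A i := by
  rw [toEuclideanLin_gram] at hx
  exact norm_apply_of_gram_eigenvector _ (sval_nonneg A i) hx1 hx

theorem sum_norm_apply_rightSingular {m n k : ℕ} {p : ℝ} (hp : 0 < p)
    {A : Matrix (Fin m) (Fin n) ℂ} {v : Fin k → EuclideanSpace ℂ (Fin n)}
    (hv : Orthonormal ℂ v)
    (hAv : ∀ i : Fin k, Matrix.toEuclideanLin (Aᴴ * A) (v i) =
      ((sval A i ^ 2 : ℝ) : ℂ) • v i) :
    ∑ i, ‖Matrix.toEuclideanLin A (v i)‖ ^ p = kyFanNorm p k A ^ p := by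
  rw [kyFanNorm_rpow hp, ← Fin.sum_univ_eq_sum_range fun i => sval A i ^ p]
  exact sum_congr rfl fun i _ => by rw [norm_apply_rightSingular (hv.norm_eq_one i) (hAv i)]

theorem norm_toEuclideanLin_add_smul_le {m n : ℕ} (A B : Matrix (Fin m) (Fin n) ℂ) {c : ℂ}
    (hc : ‖c‖ = 1) (x : EuclideanSpace ℂ (Fin n)) :
    ‖Matrix.toEuclideanLin (A + c • B) x‖ ≤
      ‖Matrix.toEuclideanLin A x‖ + ‖Matrix.toEuclideanLin B x‖ := by
  rw [map_add, map_smul, LinearMap.add_apply, LinearMap.smul_apply]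
  refine (norm_add_le _ _).trans ?_
  rw [norm_smul, hc, one_mul]

theorem kyFanNorm_add_smul_le {m n k : ℕ} (hk : 1 ≤ k) (hkn : k ≤ n) {p : ℝ} (hp : 2 ≤ p)
    {A B : Matrix (Fin m) (Fin n) ℂ} (hA : A ≠ 0) (hB : B ≠ 0) {c : ℂ} (hc : ‖c‖ = 1) :
    kyFanNorm p k (A + c • B) ≤ kyFanNorm p k A + kyFanNorm p k B := by
  have hp0 : 0 < p := by linarith
  obtain ⟨v, hv, hCv⟩ := exists_orthonormal_rightSingular hkn (A + c • B)
  have hα := kyFanNorm_pos hk p hA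
  have hβ := kyFanNorm_pos hk p hB
  have h := (sum_rpow_le_add_rpow (by linarith) hα hβ
    (fun i => norm_nonneg (Matrix.toEuclideanLin A (v i)))
    (fun i => norm_nonneg (Matrix.toEuclideanLin B (v i)))
    (fun i => norm_nonneg (Matrix.toEuclideanLin (A + c • B) (v i)))
    (fun i => norm_toEuclideanLin_add_smul_le A B hc (v i))
    (sum_norm_apply_rpow_le_kyFanNorm hk hp A hv)
    (sum_norm_apply_rpow_le_kyFanNorm hk hp B hv)).1
  rw [sum_norm_apply_rightSingular hp0 hv hCv] at h
  exact (Real.rpow_le_rpow_iff (kyFanNorm_nonneg _ _ _) (by positivity) hp0).1 h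

/-- Trace duality for right singular vectors of `A`. -/
theorem norm_sum_rpow_mul_inner_le {m n k : ℕ} (hk : 1 ≤ k) {p : ℝ} (hp : 2 ≤ p)
    (A C : Matrix (Fin m) (Fin n) ℂ) {v : Fin k → EuclideanSpace ℂ (Fin n)}
    (hv : Orthonormal ℂ v)
    (hAv : ∀ i : Fin k, Matrix.toEuclideanLin (Aᴴ * A) (v i) =
      ((sval A i ^ 2 : ℝ) : ℂ) • v i) :
    ‖∑ i : Fin k, ((sval A i ^ (p - 2) : ℝ) : ℂ) *
      inner ℂ (Matrix.toEuclideanLin A (v i)) (Matrix.toEuclideanLin C (v i))‖ ≤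
      kyFanNorm p k A ^ (p - 1) * kyFanNorm p k C := by
  have hp0 : 0 < p := by linarith
  have hp1 : 0 < p - 1 := by linarith
  have hpq : (p / (p - 1)).HolderConjugate p :=
    (Real.HolderConjugate.conjExponent (show 1 < p by linarith)).symm
  have hα := kyFanNorm_nonneg p k A
  have hσ := fun i : Fin k => sval_nonneg A i
  calc _ ≤ ∑ i : Fin k, sval A i ^ (p - 1) * ‖Matrix.toEuclideanLin C (v i)‖ := by
        refine (norm_sum_le _ _).trans (sum_le_sum fun i _ => ?_)
        rw [norm_mul, Complex.norm_of_nonneg (Real.rpow_nonneg (hσ i) _)]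
        refine (mul_le_mul_of_nonneg_left (norm_inner_le_norm _ _)
          (Real.rpow_nonneg (hσ i) _)).trans_eq ?_
        rw [norm_apply_rightSingular (hv.norm_eq_one i) (hAv i), ← mul_assoc]
        congr 1
        rw [show p - 1 = p - 2 + 1 by ring,
          Real.rpow_add_one' (hσ i) (by linarith)]
    _ ≤ (∑ i : Fin k, (sval A i ^ (p - 1)) ^ (p / (p - 1))) ^ (1 / (p / (p - 1))) *
        (∑ i, ‖Matrix.toEuclideanLin C (v i)‖ ^ p) ^ (1 / p) :=
      Real.inner_le_Lp_mul_Lq_of_nonneg _ hpq (fun i _ => Real.rpow_nonneg (hσ i) _)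
        (fun i _ => norm_nonneg _)
    _ ≤ (kyFanNorm p k A ^ p) ^ (1 / (p / (p - 1))) * (kyFanNorm p k C ^ p) ^ (1 / p) := by
      refine mul_le_mul (le_of_eq ?_) (Real.rpow_le_rpow (by positivity)
        (sum_norm_apply_rpow_le_kyFanNorm hk hp C hv) (by positivity)) (by positivity)
        (by positivity)
      rw [kyFanNorm_rpow hp0, ← Fin.sum_univ_eq_sum_range fun i => sval A i ^ p]
      congr 1
      refine sum_congr rfl fun i _ => ?_
      rw [← Real.rpow_mul (hσ i), mul_div_cancel₀ _ hp1.ne']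
    _ = _ := by
      rw [← Real.rpow_mul hα, ← Real.rpow_mul (kyFanNorm_nonneg p k C),
        mul_one_div_cancel hp0.ne', Real.rpow_one, one_div_div, mul_div_cancel₀ _ hp0.ne']

theorem sum_rpow_mul_inner_self {m n k : ℕ} {p : ℝ} (hp : 0 < p)
    (A : Matrix (Fin m) (Fin n) ℂ) {v : Fin k → EuclideanSpace ℂ (Fin n)}
    (hv : Orthonormal ℂ v)
    (hAv : ∀ i : Fin k, Matrix.toEuclideanLin (Aᴴ * A) (v i) =
      ((sval A i ^ 2 : ℝ) : ℂ) • v i) :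
    ∑ i : Fin k, ((sval A i ^ (p - 2) : ℝ) : ℂ) *
      inner ℂ (Matrix.toEuclideanLin A (v i)) (Matrix.toEuclideanLin A (v i)) =
      ((kyFanNorm p k A ^ p : ℝ) : ℂ) := by
  rw [kyFanNorm_rpow hp, ← Fin.sum_univ_eq_sum_range fun i => sval A i ^ p, Complex.ofReal_sum]
  refine sum_congr rfl fun i _ => ?_
  rw [inner_self_eq_norm_sq_to_K, norm_apply_rightSingular (hv.norm_eq_one i) (hAv i)]
  have : sval A i ^ p = sval A i ^ (p - 2) * sval A i ^ 2 := by
    rw [← Real.rpow_natCast (sval A i) 2, ← Real.rpow_add' (sval_nonneg A i)] <;>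
      simp [hp.ne']
  rw [this]
  push_cast
  rfl

theorem normParallel_of_sum_eq {m n k : ℕ} (hk : 1 ≤ k) (hkn : k ≤ n) {p : ℝ} (hp : 2 ≤ p)
    {A B : Matrix (Fin m) (Fin n) ℂ} (hA : A ≠ 0) (hB : B ≠ 0)
    {v : Fin k → EuclideanSpace ℂ (Fin n)} (hv : Orthonormal ℂ v)
    (hAv : ∀ i : Fin k, Matrix.toEuclideanLin (Aᴴ * A) (v i) =
      ((sval A i ^ 2 : ℝ) : ℂ) • v i) {c : ℂ} (hc : ‖c‖ = 1)
    (hsum : ∑ i : Fin k, ((sval A i ^ (p - 2) : ℝ) : ℂ) *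
      inner ℂ (Matrix.toEuclideanLin A (v i)) (Matrix.toEuclideanLin B (v i)) =
      c * ((kyFanNorm p k A ^ (p - 1) * kyFanNorm p k B : ℝ) : ℂ)) :
    NormParallel p k A B := by
  have hp0 : 0 < p := by linarith
  have hα := kyFanNorm_pos hk p hA
  have hβ := kyFanNorm_nonneg p k B
  have hc' : ‖star c‖ = 1 := by rw [norm_star, hc]
  have hcc : star c * c = 1 := by
    rw [Complex.star_def, Complex.conj_mul', hc]; simp
  -- The pairing is linear in its second slot, so the phase `star c` cancels `c` and the
  -- contributions of `A` and `B` add up as nonnegative reals.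
  refine ⟨star c, hc', le_antisymm (kyFanNorm_add_smul_le hk hkn hp hA hB hc') ?_⟩
  have h := norm_sum_rpow_mul_inner_le hk hp A (A + star c • B) hv hAv
  have hexp : ∑ i : Fin k, ((sval A i ^ (p - 2) : ℝ) : ℂ) *
      inner ℂ (Matrix.toEuclideanLin A (v i)) (Matrix.toEuclideanLin (A + star c • B) (v i)) =
      ((kyFanNorm p k A ^ (p - 1) * (kyFanNorm p k A + kyFanNorm p k B) : ℝ) : ℂ) := by
    simp only [map_add, map_smul, LinearMap.add_apply, LinearMap.smul_apply, inner_add_right,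
      inner_smul_right, mul_add, sum_add_distrib, mul_left_comm _ (star c)]
    rw [sum_rpow_mul_inner_self hp0 A hv hAv, ← mul_sum, hsum, ← mul_assoc, hcc, one_mul,
      ← Complex.ofReal_add, ← Real.rpow_add_one hα.ne', sub_add_cancel]
  rw [hexp, Complex.norm_of_nonneg (by positivity)] at h
  exact le_of_mul_le_mul_left h (Real.rpow_pos_of_pos hα _)

/-- Equality in the triangle inequality puts `x` and `y` on one ray; the relation between the norms
fixes the ratio. -/
theorem smul_eq_smul_of_norm_add_eq {F : Type*} [NormedAddCommGroup F] [InnerProductSpace ℂ F]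
    {x y : F} {α β : ℝ} (hα : 0 < α) (h : ‖x + y‖ = ‖x‖ + ‖y‖) (hxy : β * ‖x‖ = α * ‖y‖) :
    (α : ℂ) • y = (β : ℂ) • x := by
  let : InnerProductSpace ℝ F := InnerProductSpace.rclikeToReal ℂ F
  have h1 : ‖x‖ • y = ‖y‖ • x := sameRay_iff_norm_smul_eq.1 (sameRay_iff_norm_add.2 h)
  rw [Complex.coe_smul, Complex.coe_smul]
  rcases eq_or_ne x 0 with rfl | hx
  · have : y = 0 := by
      rw [norm_zero, mul_zero, eq_comm, mul_eq_zero] at hxy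
      exact norm_eq_zero.1 (hxy.resolve_left hα.ne')
    rw [this, smul_zero, smul_zero]
  · refine smul_right_injective F (norm_ne_zero_iff.2 hx) ?_
    simp only
    rw [smul_comm, h1, smul_smul, smul_smul, ← hxy, mul_comm]

theorem exists_sum_eq_of_kyFanNorm_add_smul {m n k : ℕ} (hk : 1 ≤ k) (hkn : k ≤ n) {p : ℝ}
    (hp : 2 ≤ p) {A B : Matrix (Fin m) (Fin n) ℂ} (hA : A ≠ 0) (hB : B ≠ 0) {c : ℂ}
    (hc : ‖c‖ = 1)
    (h : kyFanNorm p k (A + c • B) = kyFanNorm p k A + kyFanNorm p k B) :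
    ∃ u : Fin k → EuclideanSpace ℂ (Fin n), Orthonormal ℂ u ∧
      (∀ i : Fin k, Matrix.toEuclideanLin (Aᴴ * A) (u i) = ((sval A i ^ 2 : ℝ) : ℂ) • u i) ∧
      ∑ i : Fin k, ((sval A i ^ (p - 2) : ℝ) : ℂ) *
        inner ℂ (Matrix.toEuclideanLin A (u i)) (Matrix.toEuclideanLin B (u i)) =
        star c * ((kyFanNorm p k A ^ (p - 1) * kyFanNorm p k B : ℝ) : ℂ) := by
  have hp0 : 0 < p := by linarith
  have hα := kyFanNorm_pos hk p hA
  have hβ := kyFanNorm_pos hk p hB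
  obtain ⟨v, hv, hCv⟩ := exists_orthonormal_rightSingular hkn (A + c • B)
  have hmink := (sum_rpow_le_add_rpow (by linarith) hα hβ
    (fun i => norm_nonneg (Matrix.toEuclideanLin A (v i)))
    (fun i => norm_nonneg (Matrix.toEuclideanLin B (v i)))
    (fun i => norm_nonneg (Matrix.toEuclideanLin (A + c • B) (v i)))
    (fun i => norm_toEuclideanLin_add_smul_le A B hc (v i))
    (sum_norm_apply_rpow_le_kyFanNorm hk hp A hv)
    (sum_norm_apply_rpow_le_kyFanNorm hk hp B hv)).2
    (by rw [sum_norm_apply_rightSingular hp0 hv hCv, h])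
  -- The relation is needed on the whole span, since the singular vectors `u` of `A` found below are
  -- only known to lie there.
  have hprop : ∀ x ∈ Submodule.span ℂ (Set.range v),
      (kyFanNorm p k A : ℂ) • c • Matrix.toEuclideanLin B x =
        (kyFanNorm p k B : ℂ) • Matrix.toEuclideanLin A x := by
    intro x hx
    induction hx using Submodule.span_induction with
    | mem x hx =>
      obtain ⟨i, rfl⟩ := hx
      obtain ⟨h1, h2⟩ := hmink.1 i
      have hn : ‖c • Matrix.toEuclideanLin B (v i)‖ = ‖Matrix.toEuclideanLin B (v i)‖ := by
        rw [norm_smul, hc, one_mul]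
      refine smul_eq_smul_of_norm_add_eq hα ?_ (by rw [hn, h2])
      rw [hn, ← h1, map_add, map_smul, LinearMap.add_apply, LinearMap.smul_apply]
    | zero => simp
    | add x y _ _ h1 h2 => simp only [map_add, smul_add, h1, h2]
    | smul a x _ h =>
      simp only [map_smul]
      rw [smul_comm c a, smul_comm _ a, h, smul_comm a]
  obtain ⟨u, hu, huV, hAu⟩ := (sum_norm_apply_rpow_le (Matrix.toEuclideanLin A) hk hp hv).2
    (by rw [kyFanNorm_rpow hp0] at hmink; exact hmink.2)
  have hAu' : ∀ i : Fin k, Matrix.toEuclideanLin (Aᴴ * A) (u i) =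
      ((sval A i ^ 2 : ℝ) : ℂ) • u i := by
    rw [toEuclideanLin_gram]
    exact hAu
  refine ⟨u, hu, hAu', ?_⟩
  have hcc : star c * c = 1 := by
    rw [Complex.star_def, Complex.conj_mul', hc]; simp
  have hαC : (kyFanNorm p k A : ℂ) ≠ 0 := by exact_mod_cast hα.ne'
  have hB : ∀ i, Matrix.toEuclideanLin B (u i) =
      (star c * (kyFanNorm p k B : ℂ) / (kyFanNorm p k A : ℂ)) •
        Matrix.toEuclideanLin A (u i) := by
    intro i
    have := hprop (u i) (huV i)
    rw [mul_div_right_comm, mul_smul, ← this, smul_smul, smul_smul,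
      div_mul_cancel₀ _ hαC, hcc, one_smul]
  simp only [hB, inner_smul_right, mul_left_comm _ (_ / _ : ℂ)]
  rw [← mul_sum, sum_rpow_mul_inner_self hp0 A hu hAu', show kyFanNorm p k A ^ p = kyFanNorm p k A ^ (p - 1) * kyFanNorm p k A by
    rw [← Real.rpow_add_one hα.ne', sub_add_cancel]]
  push_cast
  field_simp

end Matrix

end KyFanPK

theorem mainTheorem11 {m n k : ℕ} (hk : 1 ≤ k) (hkn : k ≤ n) (p : ℝ) (hp : 2 ≤ p)
    (A B : Matrix (Fin m) (Fin n) ℂ) :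
    KyFanPK.NormParallel p k A B ↔
      ∃ v : Fin k → EuclideanSpace ℂ (Fin n),
        Orthonormal ℂ v ∧
        (∀ i : Fin k, Matrix.toEuclideanLin (Aᴴ * A) (v i) =
          ((KyFanPK.sval A i ^ 2 : ℝ) : ℂ) • v i) ∧
        ∃ c : ℂ, ‖c‖ = 1 ∧
          ∑ i : Fin k, inner ℂ (v i)
              (Matrix.toEuclideanLin (KyFanPK.gramPow A ((p - 2) / 2) * Aᴴ * B) (v i)) =
            c * ((KyFanPK.kyFanNorm p k A ^ (p - 1) * KyFanPK.kyFanNorm p k B : ℝ) : ℂ) := by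
  have hp0 : 0 < p := by linarith
  by_cases h0 : A = 0 ∨ B = 0
  · obtain ⟨v, hv, hAv⟩ := KyFanPK.exists_orthonormal_rightSingular hkn A
    have hz : KyFanPK.gramPow A ((p - 2) / 2) * Aᴴ * B = 0 ∧
        KyFanPK.kyFanNorm p k A ^ (p - 1) * KyFanPK.kyFanNorm p k B = 0 := by
      rcases h0 with rfl | rfl
      · simp [KyFanPK.kyFanNorm_zero hp0, Real.zero_rpow (show p - 1 ≠ 0 by linarith)]
      · simp [KyFanPK.kyFanNorm_zero hp0]
    -- If A or B vanishes both sides hold: any phase works, and both members of the trace identity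
    -- are 0 (p - 1 ≠ 0 is used when A = 0).
    refine iff_of_true ⟨1, norm_one, ?_⟩ ⟨v, hv, hAv, 1, norm_one, ?_⟩
    · rcases h0 with rfl | rfl <;> simp [KyFanPK.kyFanNorm_zero hp0]
    · rw [hz.1, hz.2]
      simp
  · push Not at h0
    constructor
    · rintro ⟨c, hc, h⟩
      obtain ⟨u, hu, hAu, hsum⟩ :=
        KyFanPK.exists_sum_eq_of_kyFanNorm_add_smul hk hkn hp h0.1 h0.2 hc h
      refine ⟨u, hu, hAu, star c, by rw [norm_star, hc], ?_⟩
      rw [← hsum]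
      exact Finset.sum_congr rfl fun i _ =>
        KyFanPK.inner_gramPow_apply A B p (KyFanPK.sval_nonneg A i) (hAu i)
    · rintro ⟨v, hv, hAv, c, hc, hsum⟩
      refine KyFanPK.normParallel_of_sum_eq hk hkn hp h0.1 h0.2 hv hAv hc ?_
      rw [← hsum]
      exact Finset.sum_congr rfl fun i _ =>
        (KyFanPK.inner_gramPow_apply A B p (KyFanPK.sval_nonneg A i) (hAv i)).symm
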